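/- For a measurable space $X$ let $\mathcal G X$ be the set of subprobability measures on $X$ (measures of total mass at most $1$), with the coarsest $\sigma$-algebra making all evaluations $\mu\mapsto\mu(A)$, $A\subseteq X$ measurable, measurable. For measurable $k\colon X\to Y$ write $(\mathcal G k)(\mu)=\mu(k^{-1}(-))$, and for measurable $f\colon X\to\mathcal G Y$ write $f^\sharp(\mu)(A)=\int_X f(x)(A)\,d\mu(x)$. A finite discrete space is a finite set in which all subsets are measurable. On $\overline{\mathbb R}=[-\infty,\infty]$ put $\infty+(-\infty)=-\infty$ and $\sup\varnothing=-\infty$. For $\alpha>1$ and $\mu_1,\mu_2\in\mathcal G X$, the Rényi divergence of order $\alpha$ is $$D^\alpha_X(\mu_1,\mu_2)=\frac1{\alpha-1}\log\int_X \frac{d\mu_2}{d\mu}\left(\frac{d\mu_1/d\mu}{d\mu_2/d\mu}\right)^{\alpha}d\mu ,$$ where $\mu$ is a finite measure with $\mu_1,\mu_2\ll\mu$ (for instance $\mu=\mu_1+\mu_2$; the value does not depend on the choice), with the conventions $0\cdot(0/0)^\alpha=0$, $0\cdot(a/0)^\alpha=\infty$ for $a>0$, $\log 0=-\infty$ and $\log\infty=\infty$.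 **Theorem.** For every $\alpha>1$, the divergence $D^\alpha$, regarded as a family of divergences graded by the one-element monoid, has the following properties, for all measurable spaces $X,Y$ (all maps below being measurable): 1. (reflexive) $D^\alpha_X(\mu,\mu)\le 0$ for all $\mu\in\mathcal G X$; 2. (continuous) for all $\mu_1,\mu_2\in\mathcal G X$, $D^\alpha_X(\mu_1,\mu_2)=\sup\{D^\alpha_I(\mathcal G k(\mu_1),\mathcal G k(\mu_2)) : I \text{ a finite discrete space},\ k\colon X\to I\}$; 3. (approximable) for every finite discrete space $I$, all $f,g\colon X\to\mathcal G I$ and all $\mu_1,\mu_2\in\mathcal G X$ there are finite discrete spaces $J_n$ and maps $m_n^*\colon X\to J_n$, $m_n\colon J_n\to X$ $(n\in\mathbb N)$ with $$D^\alpha_I(f^\sharp(\mu_1),g^\sharp(\mu_2))=\lim_{n\to\infty}D^\alpha_I\big((f\circ m_n\circ m_n^*)^\sharp(\mu_1),(g\circ m_n\circ m_n^*)^\sharp(\mu_2)\big);$$ 4. (composable) $D^\alpha_Y(f^\sharp(\mu_1),g^\sharp(\mu_2))\le D^\alpha_X(\mu_1,\mu_2)+\sup_{x\in X}D^\alpha_Y(f(x),g(x))$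 for all $f,g\colon X\to\mathcal G Y$ and $\mu_1,\mu_2\in\mathcal G X$; 5. (additive) $D^\alpha_{X\times Y}(\mu_1\otimes\mu_3,\mu_2\otimes\mu_4)\le D^\alpha_X(\mu_1,\mu_2)+D^\alpha_Y(\mu_3,\mu_4)$ for all $\mu_1,\mu_2\in\mathcal G X$ and $\mu_3,\mu_4\in\mathcal G Y$. -/

import Mathlib

open MeasureTheory Filter
open scoped ENNReal

universe u v

/-- The space `𝒢 X` of subprobability measures on a measurable space `X`. -/
def SubProb (X : Type u) [MeasurableSpace X] : Type u :=
  {μ : Measure X // μ Set.univ ≤ 1}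

namespace SubProb

variable {X Y : Type u} [MeasurableSpace X] [MeasurableSpace Y]

/-- The coarsest σ-algebra making all evaluations `μ ↦ μ A`, `A` measurable, measurable:
the restriction of Mathlib's σ-algebra on `Measure X`. -/
instance : MeasurableSpace (SubProb X) :=
  inferInstanceAs (MeasurableSpace {μ : Measure X // μ Set.univ ≤ 1})

instance (μ : SubProb X) : IsFiniteMeasure μ.1 :=
  ⟨μ.2.trans_lt ENNReal.one_lt_top⟩

/-- The pushforward `(𝒢 k) μ`, used for measurable `k`. -/
noncomputable def map (k : X → Y) (μ : SubProb X) : SubProb Y :=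
  ⟨Measure.map k μ.1, by
    by_cases hk : AEMeasurable k μ.1
    · rw [Measure.map_apply_of_aemeasurable hk MeasurableSet.univ]
      exact μ.2
    · rw [Measure.map_of_not_aemeasurable hk]
      simp⟩

/-- The Kleisli extension `f♯ μ = (A ↦ ∫ f(x)(A) dμ(x))`, used for measurable `f`. -/
noncomputable def bind (f : X → SubProb Y) (μ : SubProb X) : SubProb Y :=
  ⟨Measure.bind μ.1 (fun x => (f x).1), by
    by_cases hf : AEMeasurable (fun x => (f x).1) μ.1
    · rw [Measure.bind_apply MeasurableSet.univ hf]
      calc ∫⁻ x, (f x).1 Set.univ ∂μ.1 ≤ ∫⁻ _, 1 ∂μ.1 := lintegral_mono fun x => (f x).2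
        _ = μ.1 Set.univ := by simp
        _ ≤ 1 := μ.2
    · rw [Measure.bind, Measure.map_of_not_aemeasurable hf]
      simp⟩

/-- The product measure `μ ⊗ ν`. -/
noncomputable def prod (μ : SubProb X) (ν : SubProb Y) : SubProb (X × Y) :=
  ⟨μ.1.prod ν.1, by
    rw [← Set.univ_prod_univ, Measure.prod_prod]
    exact mul_le_one' μ.2 ν.2⟩

end SubProb

/-- A divergence: a family of functions `𝒢 X × 𝒢 X → [-∞, ∞]`, one for each measurable space. -/
def Divergence : Type (u + 1) :=
  ∀ (X : Type u) [MeasurableSpace X], SubProb X → SubProb X → EReal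

/-- A family of divergences graded by a preordered monoid `A`; the grading is contravariant. -/
structure GradedDivergence (A : Type v) [Monoid A] [Preorder A] [MulLeftMono A]
    [MulRightMono A] where
  div : A → Divergence.{u}
  anti : ∀ {a b : A}, a ≤ b → ∀ (X : Type u) [MeasurableSpace X] (μ₁ μ₂ : SubProb X),
    div b X μ₁ μ₂ ≤ div a X μ₁ μ₂

/-- A single divergence, as a family graded by the one-element monoid. -/
def Divergence.toGraded (Δ : Divergence.{u}) : GradedDivergence.{u} Unit where
  div _ := Δ
  anti _ _ _ _ _ := le_rfl

namespace GradedDivergence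

variable {A : Type v} [Monoid A] [Preorder A] [MulLeftMono A] [MulRightMono A]

def IsReflexive (Δ : GradedDivergence.{u} A) : Prop :=
  ∀ (a : A) (X : Type u) [MeasurableSpace X] (μ : SubProb X), Δ.div a X μ μ ≤ 0

/-- `Δ_X(μ₁, μ₂)` is the supremum of `Δ_I(𝒢k μ₁, 𝒢k μ₂)` over the finite discrete spaces `I` and
the measurable maps `k : X → I`. -/
def IsContinuous (Δ : GradedDivergence.{u} A) : Prop :=
  ∀ (a : A) (X : Type u) [MeasurableSpace X] (μ₁ μ₂ : SubProb X),
    Δ.div a X μ₁ μ₂ =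
      sSup {r : EReal | ∃ (I : Type u) (_ : MeasurableSpace I) (_ : DiscreteMeasurableSpace I)
        (_ : Finite I) (k : X → I), Measurable k ∧ r = Δ.div a I (μ₁.map k) (μ₂.map k)}

/-- For all measurable `f, g : X → 𝒢 I` with `I` finite discrete, there are finite discrete spaces
`J n` and measurable maps `X → J n → X` through which `f` and `g` can be discretized such that the
divergences of the discretized Kleisli extensions converge. -/
def IsApproximable (Δ : GradedDivergence.{u} A) : Prop :=
  ∀ (a : A) (X : Type u) [MeasurableSpace X]
    (I : Type u) [MeasurableSpace I] [DiscreteMeasurableSpace I] [Finite I]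
    (f g : X → SubProb I), Measurable f → Measurable g → ∀ μ₁ μ₂ : SubProb X,
    ∃ (J : ℕ → Type u) (_ : ∀ n, MeasurableSpace (J n))
      (_ : ∀ n, DiscreteMeasurableSpace (J n)) (_ : ∀ n, Finite (J n))
      (mstar : ∀ n, X → J n) (m : ∀ n, J n → X),
      (∀ n, Measurable (mstar n)) ∧ (∀ n, Measurable (m n)) ∧
      Tendsto
        (fun n => Δ.div a I (μ₁.bind (f ∘ m n ∘ mstar n)) (μ₂.bind (g ∘ m n ∘ mstar n)))
        atTop (nhds (Δ.div a I (μ₁.bind f) (μ₂.bind g)))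

/-- Here and below, addition on `EReal` satisfies `⊤ + ⊥ = ⊥ + ⊤ = ⊥`. -/
def IsComposable (Δ : GradedDivergence.{u} A) : Prop :=
  ∀ (a b : A) (X : Type u) [MeasurableSpace X] (Y : Type u) [MeasurableSpace Y]
    (f g : X → SubProb Y), Measurable f → Measurable g → ∀ μ₁ μ₂ : SubProb X,
    Δ.div (a * b) Y (μ₁.bind f) (μ₂.bind g) ≤ Δ.div a X μ₁ μ₂ + ⨆ x : X, Δ.div b Y (f x) (g x)

def IsAdditive (Δ : GradedDivergence.{u} A) : Prop :=
  ∀ (a b : A) (X : Type u) [MeasurableSpace X] (Y : Type u) [MeasurableSpace Y]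
    (μ₁ μ₂ : SubProb X) (μ₃ μ₄ : SubProb Y),
    Δ.div (a * b) (X × Y) (μ₁.prod μ₃) (μ₂.prod μ₄) ≤ Δ.div a X μ₁ μ₂ + Δ.div b Y μ₃ μ₄

end GradedDivergence

open scoped Classical in
/-- The integrand `b (a/b)^α`, where `α > 1`, with the conventions `0 (0/0)^α = 0` and
`0 (a/0)^α = lim_{t → 0+} t (a/t)^α = ∞` for `a > 0`. -/
noncomputable def powerIntegrand (α : ℝ) (a b : ℝ≥0∞) : ℝ≥0∞ :=
  if b = 0 then (if a = 0 then 0 else ⊤) else b * (a / b) ^ α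

/-- The integral `∫ μ₂(x) (μ₁(x)/μ₂(x))^α dx`, where `μ₁(x)` and `μ₂(x)` are the densities with
respect to a common dominating measure, here `μ₁ + μ₂`. -/
noncomputable def powerIntegral (α : ℝ) {X : Type u} [MeasurableSpace X] (μ₁ μ₂ : SubProb X) :
    ℝ≥0∞ :=
  ∫⁻ x, powerIntegrand α (μ₁.1.rnDeriv (μ₁.1 + μ₂.1) x) (μ₂.1.rnDeriv (μ₁.1 + μ₂.1) x)
    ∂(μ₁.1 + μ₂.1)

/-- The Rényi divergence of order `α` of subprobability measures,
`D^α(μ₁‖μ₂) = 1/(α-1) * log ∫ μ₂(x) (μ₁(x)/μ₂(x))^α dx`,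
with `log 0 = -∞` and `log ∞ = ∞`. -/
noncomputable def renyiDivergence (α : ℝ) : Divergence.{u} :=
  fun _ _ μ₁ μ₂ => ((1 / (α - 1) : ℝ) : EReal) * ENNReal.log (powerIntegral α μ₁ μ₂)

/-! Everything rests on φ(a, b) = b (a/b)^α, i.e. `powerIntegrand`, which is convex, homogeneous of
degree one, and multiplicative: φ(ac, bd) = φ(a, b) φ(c, d) for finite b, d. Convexity and
homogeneity give φ(∫p, ∫q) ≤ ∫φ(p, q) (`powerIntegrand_lintegral_le`), so merging points into
finitely many cells never increases the integral. Conversely, if μ₁ ≪ μ₂, the integral is ∫ r^α dμ₂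
with r the ratio of the densities, and the level sets of simple functions increasing to r give
partitions that recover it; if not, a two-cell partition already gives ∞. This is continuity, and
data processing follows. For composability, continuity reduces to finite targets, where Jensen and
multiplicativity bound the integral by a product that the logarithm turns into a sum. Additivity is
the case of the kernels sending x to the law of (x, y). For approximability, weights are rounded on
ever finer grids. Since φ is discontinuous at (0, 0), the rounding must also preserve which weights
vanish. -/

section PowerIntegrand

/-! ### Algebra, limits and convexity of the integrand. -/

variable {α : ℝ}

lemma powerIntegrand_of_ne_zero {a b : ℝ≥0∞} (hb : b ≠ 0) :
    powerIntegrand α a b = b * (a / b) ^ α := by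
  simp [powerIntegrand, hb]

lemma powerIntegrand_zero_left (hα : 1 < α) (b : ℝ≥0∞) : powerIntegrand α 0 b = 0 := by
  have h : 0 < α := by linarith
  by_cases hb : b = 0 <;> simp [powerIntegrand, hb, h]

lemma powerIntegrand_zero_right {a : ℝ≥0∞} (ha : a ≠ 0) : powerIntegrand α a 0 = ⊤ := by
  simp [powerIntegrand, ha]

lemma powerIntegrand_self {a : ℝ≥0∞} (ha : a ≠ ⊤) : powerIntegrand α a a = a := by
  by_cases h : a = 0
  · simp [powerIntegrand, h]
  · rw [powerIntegrand_of_ne_zero h, ENNReal.div_self h ha, ENNReal.one_rpow, mul_one]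

lemma powerIntegrand_ne_zero (hα : 1 < α) {a b : ℝ≥0∞} (ha : a ≠ 0) (hb : b ≠ ⊤) :
    powerIntegrand α a b ≠ 0 := by
  by_cases h : b = 0
  · simp [powerIntegrand, h, ha]
  · rw [powerIntegrand_of_ne_zero h]
    refine mul_ne_zero h fun h0 => ?_
    rcases ENNReal.rpow_eq_zero_iff.1 h0 with ⟨h1, _⟩ | ⟨_, h2⟩
    · rcases ENNReal.div_eq_zero_iff.1 h1 with h1 | h1 <;> contradiction
    · linarith

lemma powerIntegrand_mono_left (hα : 1 < α) {a a' b : ℝ≥0∞} (h : a ≤ a') :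
    powerIntegrand α a b ≤ powerIntegrand α a' b := by
  by_cases hb : b = 0
  · subst hb
    by_cases ha : a = 0
    · simp [powerIntegrand, ha]
    · rw [powerIntegrand_zero_right (fun h' => ha (le_zero_iff.1 (h' ▸ h)))]
      exact le_top
  · rw [powerIntegrand_of_ne_zero hb, powerIntegrand_of_ne_zero hb]
    have hα0 : 0 ≤ α := by linarith
    gcongr

/-- Finiteness of b and d matters at the boundary: for b = 0 and a, c nonzero the left side is ∞, so
φ(c, d) must not vanish, as it would for c finite and d = ∞. -/
lemma powerIntegrand_mul_mul (hα : 1 < α) {a b c d : ℝ≥0∞} (hb : b ≠ ⊤) (hd : d ≠ ⊤) :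
    powerIntegrand α (a * c) (b * d) = powerIntegrand α a b * powerIntegrand α c d := by
  by_cases ha : a = 0
  · simp [ha, powerIntegrand_zero_left hα]
  by_cases hc : c = 0
  · simp [hc, powerIntegrand_zero_left hα]
  by_cases hb0 : b = 0
  · rw [hb0, zero_mul, powerIntegrand_zero_right ha, powerIntegrand_zero_right (mul_ne_zero ha hc),
      ENNReal.top_mul (powerIntegrand_ne_zero hα hc hd)]
  by_cases hd0 : d = 0
  · rw [hd0, mul_zero, powerIntegrand_zero_right hc, powerIntegrand_zero_right (mul_ne_zero ha hc),
      ENNReal.mul_top (powerIntegrand_ne_zero hα ha hb)]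
  rw [powerIntegrand_of_ne_zero (mul_ne_zero hb0 hd0), powerIntegrand_of_ne_zero hb0,
    powerIntegrand_of_ne_zero hd0, ENNReal.mul_div_mul_comm (Or.inl hb0) (Or.inl hb),
    ENNReal.mul_rpow_of_nonneg _ _ (by linarith)]
  ring

lemma powerIntegrand_mul_right (hα : 1 < α) {a b t : ℝ≥0∞} (hb : b ≠ ⊤) (ht : t ≠ ⊤) :
    powerIntegrand α (a * t) (b * t) = powerIntegrand α a b * t := by
  rw [powerIntegrand_mul_mul hα hb ht, powerIntegrand_self ht]

lemma powerIntegrand_const_mul (hα : 1 < α) (c : ℝ≥0∞) {b : ℝ≥0∞} (hb : b ≠ ⊤) :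
    powerIntegrand α (c * b) b = c ^ α * b := by
  have := powerIntegrand_mul_right (a := c) (b := 1) hα ENNReal.one_ne_top hb
  rwa [one_mul, powerIntegrand_of_ne_zero one_ne_zero, one_mul, div_one] at this

lemma measurable_powerIntegrand : Measurable fun z : ℝ≥0∞ × ℝ≥0∞ => powerIntegrand α z.1 z.2 := by
  unfold powerIntegrand
  refine Measurable.ite (measurable_snd (measurableSet_singleton 0))
    (Measurable.ite (measurable_fst (measurableSet_singleton 0)) measurable_const measurable_const)
    (measurable_snd.mul ((measurable_fst.div measurable_snd).pow_const α))

/-- Convergence alone does not suffice at (0, 0). With matching zeros, the sequence is constant when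
b₀ = 0, and otherwise the formula is continuous. -/
lemma tendsto_powerIntegrand {a b : ℕ → ℝ≥0∞} {a₀ b₀ : ℝ≥0∞}
    (ha : Tendsto a atTop (nhds a₀)) (hb : Tendsto b atTop (nhds b₀)) (ha₀ : a₀ ≠ ⊤) (hb₀ : b₀ ≠ ⊤)
    (hza : ∀ n, a n = 0 ↔ a₀ = 0) (hzb : ∀ n, b n = 0 ↔ b₀ = 0) :
    Tendsto (fun n => powerIntegrand α (a n) (b n)) atTop (nhds (powerIntegrand α a₀ b₀)) := by
  by_cases h : b₀ = 0
  · have h' n : powerIntegrand α (a n) (b n) = powerIntegrand α a₀ b₀ := by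
      simp [powerIntegrand, h, (hzb n).2 h, hza n]
    simp [h']
  · have h' n : powerIntegrand α (a n) (b n) = b n * (a n / b n) ^ α :=
      powerIntegrand_of_ne_zero fun h0 => h ((hzb n).1 h0)
    simp only [h', powerIntegrand_of_ne_zero h]
    refine ENNReal.Tendsto.mul hb (Or.inl h) ?_ (Or.inr hb₀)
    exact ((ENNReal.continuous_rpow_const).tendsto _).comp
      (ENNReal.Tendsto.div ha (Or.inr h) hb (Or.inr ha₀))

/-- Jensen's inequality for the jointly convex, homogeneous function `(a, b) ↦ b (a/b)^α`. -/
lemma powerIntegrand_lintegral_le (hα : 1 < α) {X : Type*} [MeasurableSpace X] (ν : Measure X)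
    {p q : X → ℝ≥0∞} (hp : Measurable p) (hq : Measurable q) (hq' : ∫⁻ x, q x ∂ν ≠ ⊤) :
    powerIntegrand α (∫⁻ x, p x ∂ν) (∫⁻ x, q x ∂ν) ≤ ∫⁻ x, powerIntegrand α (p x) (q x) ∂ν := by
  have hα0 : 0 < α := by linarith
  have hm : Measurable fun x => powerIntegrand α (p x) (q x) :=
    measurable_powerIntegrand.comp (hp.prodMk hq)
  by_cases htop : ∫⁻ x, powerIntegrand α (p x) (q x) ∂ν = ⊤
  · simp [htop]
  have hpq : α.HolderConjugate (Real.conjExponent α) := .conjExponent hα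
  -- Hölder applied to p = φ(p, q)^(1/α) · q^(1/α'), where α' is the conjugate exponent. The
  -- identity holds almost everywhere because a finite integral of φ forces p = 0 where q = 0.
  have hle : ∫⁻ x, p x ∂ν ≤ (∫⁻ x, powerIntegrand α (p x) (q x) ∂ν) ^ (1 / α) *
      (∫⁻ x, q x ∂ν) ^ (1 / Real.conjExponent α) := by
    have hH := ENNReal.lintegral_mul_le_Lp_mul_Lq ν hpq
      (f := fun x => powerIntegrand α (p x) (q x) ^ (1 / α))
      (g := fun x => q x ^ (1 / Real.conjExponent α))
      (hm.pow_const _).aemeasurable (hq.pow_const _).aemeasurable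
    simp only [← ENNReal.rpow_mul, one_div, inv_mul_cancel₀ hpq.ne_zero,
      inv_mul_cancel₀ hpq.symm.ne_zero, ENNReal.rpow_one] at hH
    simp only [one_div]
    refine le_trans (lintegral_mono_ae ?_) hH
    filter_upwards [ae_lt_top hm htop, ae_lt_top hq hq'] with x hx hqx
    simp only [Pi.mul_apply]
    by_cases hq0 : q x = 0
    · by_cases hp0 : p x = 0
      · simp [hp0]
      · rw [hq0, powerIntegrand_zero_right hp0] at hx
        exact absurd hx (lt_irrefl _)
    · rw [powerIntegrand_of_ne_zero hq0, ENNReal.mul_rpow_of_nonneg _ _ (inv_nonneg.2 hα0.le),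
        ← ENNReal.rpow_mul, mul_inv_cancel₀ hα0.ne', ENNReal.rpow_one, mul_right_comm,
        ← ENNReal.rpow_add _ _ hq0 hqx.ne, hpq.inv_add_inv_eq_one, ENNReal.rpow_one,
        ENNReal.mul_div_cancel hq0 hqx.ne]
  by_cases hQ : ∫⁻ x, q x ∂ν = 0
  · rw [hQ, ENNReal.zero_rpow_of_pos (by simpa using hpq.symm.pos), mul_zero] at hle
    rw [le_zero_iff.1 hle, powerIntegrand_zero_left hα]
    exact zero_le
  rw [powerIntegrand_of_ne_zero hQ]
  set A := ∫⁻ x, p x ∂ν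
  set B := ∫⁻ x, q x ∂ν
  set P := ∫⁻ x, powerIntegrand α (p x) (q x) ∂ν
  -- Dividing by B leaves the exponent 1/α' - 1 = -1/α.
  have hdiv : A / B ≤ P ^ (1 / α) * B ^ (-(1 / α)) := by
    refine (ENNReal.div_le_div_right hle B).trans_eq ?_
    rw [mul_div_assoc]
    congr 1
    nth_rewrite 2 [← ENNReal.rpow_one B]
    rw [← ENNReal.rpow_sub _ _ hQ hq']
    congr 1
    have := hpq.inv_add_inv_eq_one
    simp only [one_div]
    linarith
  calc B * (A / B) ^ α ≤ B * (P ^ (1 / α) * B ^ (-(1 / α))) ^ α := by gcongr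
    _ = P := by
      rw [ENNReal.mul_rpow_of_nonneg _ _ hα0.le, ← ENNReal.rpow_mul, ← ENNReal.rpow_mul,
        neg_mul, one_div, inv_mul_cancel₀ hα0.ne', ENNReal.rpow_one, ENNReal.rpow_neg_one,
        mul_left_comm, ENNReal.mul_inv_cancel hQ hq', mul_one]

end PowerIntegrand

/-! ### The logarithmic scale. -/

section RenyiLog

/-- The increasing bijection `x ↦ 1/(α-1) * log x` from `[0, ∞]` to `[-∞, ∞]`. -/
noncomputable def renyiLog (α : ℝ) (x : ℝ≥0∞) : EReal :=
  ((1 / (α - 1) : ℝ) : EReal) * ENNReal.log x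

lemma renyiDivergence_eq (α : ℝ) {X : Type u} [MeasurableSpace X] (μ₁ μ₂ : SubProb X) :
    renyiDivergence α X μ₁ μ₂ = renyiLog α (powerIntegral α μ₁ μ₂) := rfl

variable {α : ℝ}

lemma renyiLog_coeff_pos (hα : 1 < α) : (0 : EReal) < ((1 / (α - 1) : ℝ) : EReal) := by
  have : 0 < 1 / (α - 1) := one_div_pos.2 (by linarith)
  exact_mod_cast this

lemma renyiLog_mono (hα : 1 < α) : Monotone (renyiLog α) := fun _ _ h =>
  mul_le_mul_of_nonneg_left (ENNReal.log_monotone h) (renyiLog_coeff_pos hα).le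

lemma continuous_renyiLog : Continuous (renyiLog α) := by
  refine continuous_iff_continuousAt.2 fun x => ?_
  refine EReal.Tendsto.const_mul ENNReal.continuous_log.continuousAt ?_ ?_
  · exact Or.inl (EReal.coe_ne_bot _)
  · exact Or.inl (EReal.coe_ne_top _)

/-- A continuous monotone map commutes with suprema; an empty index type is covered because 0 is
sent to -∞. -/
lemma renyiLog_iSup (hα : 1 < α) {ι : Sort*} (p : ι → ℝ≥0∞) :
    renyiLog α (⨆ i, p i) = ⨆ i, renyiLog α (p i) := by
  refine (renyiLog_mono hα).map_iSup_of_continuousAt continuous_renyiLog.continuousAt ?_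
  simp only [renyiLog, bot_eq_zero, ENNReal.log_zero]
  exact EReal.mul_bot_of_pos (renyiLog_coeff_pos hα)

/-- The convention ∞ + (-∞) = -∞ matches 0 · ∞ = 0, so no case is excluded. -/
lemma renyiLog_mul (hα : 1 < α) (x y : ℝ≥0∞) : renyiLog α (x * y) = renyiLog α x + renyiLog α y := by
  rw [renyiLog, ENNReal.log_mul_add, EReal.left_distrib_of_nonneg_of_ne_top
    (renyiLog_coeff_pos hα).le (EReal.coe_ne_top _)]
  rfl

end RenyiLog

/-! ### Densities, and approximation of the integral by finite partitions. -/

section PowerIntegral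

variable {α : ℝ} {X : Type u} [MeasurableSpace X]

/-- The density of the first of two subprobability measures with respect to their sum. -/
noncomputable def densityLeft (μ₁ μ₂ : SubProb X) : X → ℝ≥0∞ := μ₁.1.rnDeriv (μ₁.1 + μ₂.1)

/-- The density of the second of two subprobability measures with respect to their sum. -/
noncomputable def densityRight (μ₁ μ₂ : SubProb X) : X → ℝ≥0∞ := μ₂.1.rnDeriv (μ₁.1 + μ₂.1)

variable (μ₁ μ₂ : SubProb X)

lemma measurable_densityLeft : Measurable (densityLeft μ₁ μ₂) := Measure.measurable_rnDeriv _ _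

lemma measurable_densityRight : Measurable (densityRight μ₁ μ₂) := Measure.measurable_rnDeriv _ _

lemma measurable_powerIntegrand_density : Measurable fun x =>
    powerIntegrand α (densityLeft μ₁ μ₂ x) (densityRight μ₁ μ₂ x) :=
  measurable_powerIntegrand.comp
    ((measurable_densityLeft μ₁ μ₂).prodMk (measurable_densityRight μ₁ μ₂))

lemma withDensity_densityLeft : (μ₁.1 + μ₂.1).withDensity (densityLeft μ₁ μ₂) = μ₁.1 :=
  Measure.withDensity_rnDeriv_eq _ _ (Measure.AbsolutelyContinuous.rfl.add_right _)

lemma withDensity_densityRight : (μ₁.1 + μ₂.1).withDensity (densityRight μ₁ μ₂) = μ₂.1 := by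
  refine Measure.withDensity_rnDeriv_eq _ _ ?_
  rw [add_comm]
  exact Measure.AbsolutelyContinuous.rfl.add_right _

lemma densityRight_ne_top : ∀ᵐ x ∂(μ₁.1 + μ₂.1), densityRight μ₁ μ₂ x ≠ ⊤ :=
  Measure.rnDeriv_ne_top _ _

lemma setLIntegral_densityLeft {s : Set X} (hs : MeasurableSet s) :
    ∫⁻ x in s, densityLeft μ₁ μ₂ x ∂(μ₁.1 + μ₂.1) = μ₁.1 s := by
  rw [← withDensity_apply _ hs, withDensity_densityLeft]

lemma setLIntegral_densityRight {s : Set X} (hs : MeasurableSet s) :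
    ∫⁻ x in s, densityRight μ₁ μ₂ x ∂(μ₁.1 + μ₂.1) = μ₂.1 s := by
  rw [← withDensity_apply _ hs, withDensity_densityRight]

lemma densityRight_ne_zero : ∀ᵐ x ∂μ₂.1, densityRight μ₁ μ₂ x ≠ 0 := by
  nth_rewrite 1 [← withDensity_densityRight μ₁ μ₂]
  rw [ae_withDensity_iff (measurable_densityRight μ₁ μ₂)]
  exact Eventually.of_forall fun _ h => h

lemma lintegral_eq_lintegral_mul_densityLeft {f : X → ℝ≥0∞} (hf : Measurable f) :
    ∫⁻ x, f x ∂μ₁.1 = ∫⁻ x, densityLeft μ₁ μ₂ x * f x ∂(μ₁.1 + μ₂.1) := by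
  nth_rewrite 1 [← withDensity_densityLeft μ₁ μ₂]
  exact lintegral_withDensity_eq_lintegral_mul _ (measurable_densityLeft μ₁ μ₂) hf

lemma lintegral_eq_lintegral_mul_densityRight {f : X → ℝ≥0∞} (hf : Measurable f) :
    ∫⁻ x, f x ∂μ₂.1 = ∫⁻ x, densityRight μ₁ μ₂ x * f x ∂(μ₁.1 + μ₂.1) := by
  nth_rewrite 1 [← withDensity_densityRight μ₁ μ₂]
  exact lintegral_withDensity_eq_lintegral_mul _ (measurable_densityRight μ₁ μ₂) hf

lemma powerIntegral_eq : powerIntegral α μ₁ μ₂ =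
    ∫⁻ x, powerIntegrand α (densityLeft μ₁ μ₂ x) (densityRight μ₁ μ₂ x) ∂(μ₁.1 + μ₂.1) := rfl

lemma powerIntegral_self (μ : SubProb X) : powerIntegral α μ μ = μ.1 Set.univ := by
  rw [powerIntegral_eq, ← setLIntegral_densityRight μ μ MeasurableSet.univ,
    setLIntegral_univ]
  refine lintegral_congr_ae ?_
  filter_upwards [densityRight_ne_top μ μ] with x hx
  exact powerIntegrand_self hx

lemma powerIntegrand_measure_le (hα : 1 < α) {s : Set X} (hs : MeasurableSet s) :
    powerIntegrand α (μ₁.1 s) (μ₂.1 s) ≤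
      ∫⁻ x in s, powerIntegrand α (densityLeft μ₁ μ₂ x) (densityRight μ₁ μ₂ x)
        ∂(μ₁.1 + μ₂.1) := by
  have h := powerIntegrand_lintegral_le hα ((μ₁.1 + μ₂.1).restrict s)
    (measurable_densityLeft μ₁ μ₂) (measurable_densityRight μ₁ μ₂)
    (by rw [setLIntegral_densityRight _ _ hs]; exact measure_ne_top _ _)
  rwa [setLIntegral_densityLeft _ _ hs, setLIntegral_densityRight _ _ hs] at h

lemma powerIntegral_eq_sum (hα : 1 < α) {I : Type u} [MeasurableSpace I]
    [DiscreteMeasurableSpace I] [Fintype I] (μ₁ μ₂ : SubProb I) :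
    powerIntegral α μ₁ μ₂ = ∑ i, powerIntegrand α (μ₁.1 {i}) (μ₂.1 {i}) := by
  rw [powerIntegral_eq, lintegral_fintype]
  refine Finset.sum_congr rfl fun i _ => ?_
  rw [← setLIntegral_densityLeft μ₁ μ₂ (measurableSet_singleton i),
    ← setLIntegral_densityRight μ₁ μ₂ (measurableSet_singleton i),
    lintegral_singleton, lintegral_singleton]
  -- The density at a null atom is arbitrary but carries no weight. At a charged atom it is finite,
  -- and homogeneity absorbs the mass of the atom.
  by_cases h : (μ₁.1 + μ₂.1) {i} = 0
  · simp only [h, mul_zero, powerIntegrand_zero_left hα]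
  · have hne : densityRight μ₁ μ₂ i ≠ ⊤ := by
      intro htop
      exact h (measure_mono_null (fun j hj => by simpa [hj.symm] using hj ▸ htop)
        (densityRight_ne_top μ₁ μ₂))
    rw [powerIntegrand_mul_right hα hne (measure_ne_top _ _)]

lemma SubProb.map_val {Y : Type u} [MeasurableSpace Y] (k : X → Y) (μ : SubProb X) :
    (μ.map k).1 = Measure.map k μ.1 := rfl

lemma powerIntegral_map_eq_sum (hα : 1 < α) {I : Type u} [MeasurableSpace I]
    [DiscreteMeasurableSpace I] [Fintype I] {k : X → I} (hk : Measurable k) :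
    powerIntegral α (μ₁.map k) (μ₂.map k) =
      ∑ i, powerIntegrand α (μ₁.1 (k ⁻¹' {i})) (μ₂.1 (k ⁻¹' {i})) := by
  simp only [powerIntegral_eq_sum hα, SubProb.map_val,
    Measure.map_apply hk (measurableSet_singleton _)]

lemma lintegral_eq_sum_preimage {I : Type*} [MeasurableSpace I] [DiscreteMeasurableSpace I]
    [Fintype I] {k : X → I} (hk : Measurable k) (ν : Measure X) (f : X → ℝ≥0∞) :
    ∫⁻ x, f x ∂ν = ∑ i, ∫⁻ x in k ⁻¹' {i}, f x ∂ν := by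
  rw [← tsum_fintype (L := .unconditional I),
    ← lintegral_iUnion (fun i => hk (measurableSet_singleton i))
    (fun i j hij => Disjoint.preimage k (Set.disjoint_singleton.2 hij)), ← Set.preimage_iUnion,
    Set.iUnion_of_singleton, Set.preimage_univ, setLIntegral_univ]

lemma powerIntegral_map_le_of_finite (hα : 1 < α) {I : Type u} [MeasurableSpace I]
    [DiscreteMeasurableSpace I] [Finite I] {k : X → I} (hk : Measurable k) :
    powerIntegral α (μ₁.map k) (μ₂.map k) ≤ powerIntegral α μ₁ μ₂ := by
  have := Fintype.ofFinite I
  rw [powerIntegral_map_eq_sum μ₁ μ₂ hα hk, powerIntegral_eq, lintegral_eq_sum_preimage hk]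
  exact Finset.sum_le_sum fun i _ =>
    powerIntegrand_measure_le μ₁ μ₂ hα (hk (measurableSet_singleton i))

/-- Any finite measurable partition is realised by a map to a finite discrete space in the universe
of `X`. -/
lemma exists_powerIntegral_map_eq_sum (hα : 1 < α) {K : Type} [Fintype K] (k : X → K)
    (hk : ∀ i, MeasurableSet (k ⁻¹' {i})) :
    ∃ (I : Type u) (_ : MeasurableSpace I) (_ : DiscreteMeasurableSpace I) (_ : Finite I)
      (l : X → I), Measurable l ∧ powerIntegral α (μ₁.map l) (μ₂.map l) =
        ∑ i, powerIntegrand α (μ₁.1 (k ⁻¹' {i})) (μ₂.1 (k ⁻¹' {i})) := by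
  let _ : MeasurableSpace (ULift.{u} K) := ⊤
  have hpre (i : K) : (fun x => ULift.up.{u} (k x)) ⁻¹' {ULift.up i} = k ⁻¹' {i} := by
    ext x
    simp
  have hl : Measurable fun x => ULift.up.{u} (k x) :=
    measurable_to_countable' fun i => by
      rw [show i = ULift.up i.down from rfl, hpre]
      exact hk _
  refine ⟨ULift.{u} K, ⊤, inferInstance, inferInstance, _, hl, ?_⟩
  rw [powerIntegral_map_eq_sum μ₁ μ₂ hα hl]
  exact Fintype.sum_equiv Equiv.ulift _ _ fun i => by
    rw [show i = ULift.up i.down from rfl, hpre]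
    rfl

/-- The indicator of a μ₂-null set charged by μ₁ contributes the summand φ(a, 0) = ∞. -/
lemma exists_powerIntegral_map_eq_top (hα : 1 < α) (h : ¬ μ₁.1 ≪ μ₂.1) :
    ∃ (I : Type u) (_ : MeasurableSpace I) (_ : DiscreteMeasurableSpace I) (_ : Finite I)
      (k : X → I), Measurable k ∧ powerIntegral α (μ₁.map k) (μ₂.map k) = ⊤ := by
  classical
  obtain ⟨s, hs, h₂, h₁⟩ : ∃ s, MeasurableSet s ∧ μ₂.1 s = 0 ∧ μ₁.1 s ≠ 0 := by
    by_contra! hcon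
    exact h (Measure.AbsolutelyContinuous.mk fun s hs h₂ => hcon s hs h₂)
  have htrue : (fun x => decide (x ∈ s)) ⁻¹' {true} = s := by ext; simp
  have hfalse : (fun x => decide (x ∈ s)) ⁻¹' {false} = sᶜ := by ext; simp
  obtain ⟨I, hI, hI', hI'', k, hk, hsum⟩ := exists_powerIntegral_map_eq_sum μ₁ μ₂ hα
    (fun x => decide (x ∈ s)) (by
      rintro (_ | _)
      · rw [hfalse]
        exact hs.compl
      · rwa [htrue])
  refine ⟨I, hI, hI', hI'', k, hk, ?_⟩
  rw [hsum, Fintype.sum_bool, htrue, h₂, powerIntegrand_zero_right h₁, top_add]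

/-- In this form the integrand is increasing in the ratio, which prepares monotone convergence.
Absolute continuity makes the set where the second density vanishes null for the sum as well. -/
lemma powerIntegral_eq_lintegral_rpow (h : μ₁.1 ≪ μ₂.1) :
    powerIntegral α μ₁ μ₂ =
      ∫⁻ x, (densityLeft μ₁ μ₂ x / densityRight μ₁ μ₂ x) ^ α ∂μ₂.1 := by
  have hac : μ₁.1 + μ₂.1 ≪ μ₂.1 := Measure.AbsolutelyContinuous.add_left h .rfl
  have hm : Measurable fun x => (densityLeft μ₁ μ₂ x / densityRight μ₁ μ₂ x) ^ α :=
    ((measurable_densityLeft μ₁ μ₂).div (measurable_densityRight μ₁ μ₂)).pow_const α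
  rw [lintegral_eq_lintegral_mul_densityRight μ₁ μ₂ hm, powerIntegral_eq]
  refine lintegral_congr_ae ?_
  filter_upwards [hac.ae_le (densityRight_ne_zero μ₁ μ₂)] with x hx
  exact powerIntegrand_of_ne_zero hx

/-- On the cell s = c the densities satisfy c q ≤ p, hence c μ₂ ≤ μ₁ there, and c^α μ₂ = φ(c μ₂, μ₂)
≤ φ(μ₁, μ₂) by monotonicity in the first argument. -/
lemma lintegral_simpleFunc_rpow_le (hα : 1 < α) (h : μ₁.1 ≪ μ₂.1) (s : SimpleFunc X ℝ≥0∞)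
    (hs : ∀ x, s x ≤ densityLeft μ₁ μ₂ x / densityRight μ₁ μ₂ x) :
    ∫⁻ x, s x ^ α ∂μ₂.1 ≤
      ∑ c : s.range, powerIntegrand α (μ₁.1 (s ⁻¹' {c.1})) (μ₂.1 (s ⁻¹' {c.1})) := by
  have hac : μ₁.1 + μ₂.1 ≪ μ₂.1 := Measure.AbsolutelyContinuous.add_left h .rfl
  have hsum : ∫⁻ x, s x ^ α ∂μ₂.1 = ∑ c : s.range, c.1 ^ α * μ₂.1 (s ⁻¹' {c.1}) := by
    rw [Finset.sum_coe_sort s.range fun c => c ^ α * μ₂.1 (s ⁻¹' {c}),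
      ← SimpleFunc.map_lintegral (fun c => c ^ α) s, ← SimpleFunc.lintegral_eq_lintegral]
    rfl
  rw [hsum]
  refine Finset.sum_le_sum fun c _ => ?_
  have hm : MeasurableSet (s ⁻¹' {c.1}) := s.measurableSet_fiber c.1
  rw [← powerIntegrand_const_mul hα c.1 (measure_ne_top μ₂.1 _)]
  refine powerIntegrand_mono_left hα ?_
  rw [← setLIntegral_densityLeft μ₁ μ₂ hm, ← setLIntegral_densityRight μ₁ μ₂ hm,
    ← lintegral_const_mul _ (measurable_densityRight μ₁ μ₂)]
  refine setLIntegral_mono_ae (measurable_densityLeft μ₁ μ₂).aemeasurable ?_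
  filter_upwards [hac.ae_le (densityRight_ne_zero μ₁ μ₂), densityRight_ne_top μ₁ μ₂]
    with x hx hx' hxc
  calc c.1 * densityRight μ₁ μ₂ x
      ≤ densityLeft μ₁ μ₂ x / densityRight μ₁ μ₂ x * densityRight μ₁ μ₂ x := by
        gcongr
        rw [← show s x = c.1 from hxc]
        exact hs x
    _ = densityLeft μ₁ μ₂ x := ENNReal.div_mul_cancel hx hx'

lemma exists_le_iSup_powerIntegral_map (hα : 1 < α) (h : μ₁.1 ≪ μ₂.1) :
    ∃ (I : ℕ → Type u) (_ : ∀ n, MeasurableSpace (I n)) (_ : ∀ n, DiscreteMeasurableSpace (I n))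
      (_ : ∀ n, Finite (I n)) (k : ∀ n, X → I n), (∀ n, Measurable (k n)) ∧
      powerIntegral α μ₁ μ₂ ≤ ⨆ n, powerIntegral α (μ₁.map (k n)) (μ₂.map (k n)) := by
  have hα0 : 0 < α := by linarith
  set r : X → ℝ≥0∞ := fun x => densityLeft μ₁ μ₂ x / densityRight μ₁ μ₂ x with hr
  have hrm : Measurable r := (measurable_densityLeft μ₁ μ₂).div (measurable_densityRight μ₁ μ₂)
  let s := SimpleFunc.eapprox r
  have hfiber (n : ℕ) (c : (s n).range) :
      (fun x => (⟨s n x, (s n).mem_range_self x⟩ : (s n).range)) ⁻¹' {c} = s n ⁻¹' {c.1} := by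
    ext x
    simp [Subtype.ext_iff]
  choose I hI hI' hI'' k hk hsum using fun n => exists_powerIntegral_map_eq_sum (α := α) μ₁ μ₂ hα
    (fun x => (⟨s n x, (s n).mem_range_self x⟩ : (s n).range)) (fun c => by
      rw [hfiber]
      exact (s n).measurableSet_fiber c.1)
  refine ⟨I, hI, hI', hI'', k, hk, ?_⟩
  have hsup (x : X) : r x ^ α = ⨆ n, s n x ^ α := by
    rw [← SimpleFunc.iSup_eapprox_apply hrm x]
    exact (ENNReal.orderIsoRpow α hα0).map_iSup _
  rw [powerIntegral_eq_lintegral_rpow μ₁ μ₂ h]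
  change ∫⁻ x, r x ^ α ∂μ₂.1 ≤ _
  simp only [hsup]
  rw [lintegral_iSup (fun n => (s n).measurable.pow_const α) fun m n hmn x =>
    ENNReal.rpow_le_rpow (SimpleFunc.monotone_eapprox r hmn x) hα0.le]
  refine iSup_mono fun n => ?_
  refine (lintegral_simpleFunc_rpow_le μ₁ μ₂ hα h (s n) fun x => ?_).trans_eq ?_
  · exact (le_iSup (fun n => s n x) n).trans_eq (SimpleFunc.iSup_eapprox_apply hrm x)
  · rw [hsum]
    simp only [hfiber]

end PowerIntegral

/-! ### Reflexivity, continuity, data processing, composability and additivity. -/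

section Properties

variable {α : ℝ}

lemma renyiDivergence_isReflexive (hα : 1 < α) :
    (renyiDivergence.{u} α).toGraded.IsReflexive := by
  intro _ X _ μ
  change renyiDivergence α X μ μ ≤ 0
  rw [renyiDivergence_eq, powerIntegral_self]
  exact mul_nonpos_of_nonneg_of_nonpos (renyiLog_coeff_pos hα).le (ENNReal.log_le_zero_iff.2 μ.2)

lemma renyiDivergence_isContinuous (hα : 1 < α) :
    (renyiDivergence.{u} α).toGraded.IsContinuous := by
  intro _ X _ μ₁ μ₂
  refine le_antisymm ?_ ?_
  · change renyiDivergence α X μ₁ μ₂ ≤ _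
    by_cases h : μ₁.1 ≪ μ₂.1
    · obtain ⟨I, hI, hI', hI'', k, hk, hle⟩ := exists_le_iSup_powerIntegral_map μ₁ μ₂ hα h
      refine (renyiLog_mono hα hle).trans ?_
      rw [renyiLog_iSup hα]
      exact iSup_le fun n => le_sSup ⟨I n, hI n, hI' n, hI'' n, k n, hk n, rfl⟩
    · obtain ⟨I, hI, hI', hI'', k, hk, htop⟩ := exists_powerIntegral_map_eq_top μ₁ μ₂ hα h
      refine (renyiLog_mono hα (le_top.trans_eq htop.symm)).trans ?_
      exact le_sSup ⟨I, hI, hI', hI'', k, hk, rfl⟩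
  · refine sSup_le ?_
    rintro _ ⟨I, hI, hI', hI'', k, hk, rfl⟩
    exact renyiLog_mono hα (powerIntegral_map_le_of_finite μ₁ μ₂ hα hk)

lemma SubProb.map_map {X Y Z : Type u} [MeasurableSpace X] [MeasurableSpace Y] [MeasurableSpace Z]
    {l : Y → Z} {k : X → Y} (hl : Measurable l) (hk : Measurable k) (μ : SubProb X) :
    (μ.map k).map l = μ.map (l ∘ k) :=
  Subtype.ext (Measure.map_map hl hk)

lemma SubProb.bind_apply {X Y : Type u} [MeasurableSpace X] [MeasurableSpace Y] {f : X → SubProb Y}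
    (hf : Measurable f) (μ : SubProb X) {s : Set Y} (hs : MeasurableSet s) :
    (μ.bind f).1 s = ∫⁻ x, (f x).1 s ∂μ.1 :=
  Measure.bind_apply hs (measurable_subtype_coe.comp hf).aemeasurable

lemma SubProb.measurable_coe_apply {X Y : Type u} [MeasurableSpace X] [MeasurableSpace Y]
    {f : X → SubProb Y} (hf : Measurable f) {s : Set Y} (hs : MeasurableSet s) :
    Measurable fun x => (f x).1 s :=
  (Measure.measurable_coe hs).comp (measurable_subtype_coe.comp hf)

/-- The data processing inequality. -/
lemma renyiDivergence_map_le (hα : 1 < α) {X Y : Type u} [MeasurableSpace X] [MeasurableSpace Y]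
    {k : X → Y} (hk : Measurable k) (μ₁ μ₂ : SubProb X) :
    renyiDivergence α Y (μ₁.map k) (μ₂.map k) ≤ renyiDivergence α X μ₁ μ₂ := by
  have h := renyiDivergence_isContinuous hα () Y (μ₁.map k) (μ₂.map k)
  refine h.trans_le (sSup_le ?_)
  rintro _ ⟨I, hI, hI', hI'', l, hl, rfl⟩
  -- A finite partition of Y pulls back along k to one of X.
  rw [SubProb.map_map hl hk, SubProb.map_map hl hk]
  exact renyiLog_mono hα (powerIntegral_map_le_of_finite μ₁ μ₂ hα (hl.comp hk))

/-- Jensen moves φ inside the integral over x; multiplicativity then splits off the densities of μ₁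
and μ₂, and summing over i leaves the power integral of f x and g x. -/
lemma powerIntegral_bind_le_of_finite (hα : 1 < α) {X : Type u} [MeasurableSpace X] {I : Type u}
    [MeasurableSpace I] [DiscreteMeasurableSpace I] [Finite I] {f g : X → SubProb I}
    (hf : Measurable f) (hg : Measurable g) (μ₁ μ₂ : SubProb X) :
    powerIntegral α (μ₁.bind f) (μ₂.bind g) ≤
      powerIntegral α μ₁ μ₂ * ⨆ x, powerIntegral α (f x) (g x) := by
  have := Fintype.ofFinite I
  have hfi (i : I) := SubProb.measurable_coe_apply hf (measurableSet_singleton i)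
  have hgi (i : I) := SubProb.measurable_coe_apply hg (measurableSet_singleton i)
  have hp := measurable_densityLeft μ₁ μ₂
  have hq := measurable_densityRight μ₁ μ₂
  calc powerIntegral α (μ₁.bind f) (μ₂.bind g)
      ≤ ∑ i, ∫⁻ x, powerIntegrand α (densityLeft μ₁ μ₂ x * (f x).1 {i})
          (densityRight μ₁ μ₂ x * (g x).1 {i}) ∂(μ₁.1 + μ₂.1) := by
        rw [powerIntegral_eq_sum hα]
        refine Finset.sum_le_sum fun i _ => ?_
        have htop := measure_ne_top (μ₂.bind g).1 {i}
        rw [SubProb.bind_apply hg _ (measurableSet_singleton i),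
          lintegral_eq_lintegral_mul_densityRight μ₁ μ₂ (hgi i)] at htop ⊢
        rw [SubProb.bind_apply hf _ (measurableSet_singleton i),
          lintegral_eq_lintegral_mul_densityLeft μ₁ μ₂ (hfi i)]
        exact powerIntegrand_lintegral_le hα _ (hp.mul (hfi i)) (hq.mul (hgi i)) htop
    _ = ∫⁻ x, ∑ i, powerIntegrand α (densityLeft μ₁ μ₂ x * (f x).1 {i})
          (densityRight μ₁ μ₂ x * (g x).1 {i}) ∂(μ₁.1 + μ₂.1) :=
        (lintegral_finsetSum _ fun i _ => measurable_powerIntegrand.comp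
          ((hp.mul (hfi i)).prodMk (hq.mul (hgi i)))).symm
    _ ≤ ∫⁻ x, powerIntegrand α (densityLeft μ₁ μ₂ x) (densityRight μ₁ μ₂ x) *
          ⨆ x, powerIntegral α (f x) (g x) ∂(μ₁.1 + μ₂.1) := by
        refine lintegral_mono_ae ?_
        filter_upwards [densityRight_ne_top μ₁ μ₂] with x hx
        simp only [powerIntegrand_mul_mul hα hx (measure_ne_top (g x).1 _)]
        rw [← Finset.mul_sum, ← powerIntegral_eq_sum hα]
        gcongr
        exact le_iSup (fun x => powerIntegral α (f x) (g x)) x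
    _ = powerIntegral α μ₁ μ₂ * ⨆ x, powerIntegral α (f x) (g x) :=
        lintegral_mul_const _ (measurable_powerIntegrand_density μ₁ μ₂)

lemma SubProb.measurable_map {X Y : Type u} [MeasurableSpace X] [MeasurableSpace Y] {k : X → Y}
    (hk : Measurable k) : Measurable (SubProb.map k) :=
  ((Measure.measurable_map k hk).comp measurable_subtype_coe).subtype_mk

lemma SubProb.map_bind {X Y Z : Type u} [MeasurableSpace X] [MeasurableSpace Y] [MeasurableSpace Z]
    {f : X → SubProb Y} (hf : Measurable f) {k : Y → Z} (hk : Measurable k) (μ : SubProb X) :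
    (μ.bind f).map k = μ.bind fun x => (f x).map k := by
  refine Subtype.ext (Measure.ext fun s hs => ?_)
  have hkf : Measurable fun x => (f x).map k := (SubProb.measurable_map hk).comp hf
  rw [SubProb.map_val, Measure.map_apply hk hs, SubProb.bind_apply hf _ (hk hs),
    SubProb.bind_apply hkf _ hs]
  simp only [SubProb.map_val, Measure.map_apply hk hs]

lemma renyiDivergence_isComposable (hα : 1 < α) :
    (renyiDivergence.{u} α).toGraded.IsComposable := by
  intro _ _ X _ Y _ f g hf hg μ₁ μ₂
  change renyiDivergence α Y (μ₁.bind f) (μ₂.bind g) ≤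
    renyiDivergence α X μ₁ μ₂ + ⨆ x, renyiDivergence α Y (f x) (g x)
  refine (renyiDivergence_isContinuous hα () Y (μ₁.bind f) (μ₂.bind g)).trans_le (sSup_le ?_)
  rintro _ ⟨I, hI, hI', hI'', k, hk, rfl⟩
  -- Post-composing the kernels with k reduces to a finite target; data processing then bounds the
  -- divergences of the coarsened kernels by the original ones.
  rw [SubProb.map_bind hf hk, SubProb.map_bind hg hk]
  refine (renyiLog_mono hα (powerIntegral_bind_le_of_finite hα ((SubProb.measurable_map hk).comp hf)
    ((SubProb.measurable_map hk).comp hg) μ₁ μ₂)).trans ?_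
  rw [renyiLog_mul hα, renyiLog_iSup hα]
  gcongr with x
  · rfl
  · exact renyiDivergence_map_le hα hk (f x) (g x)

lemma SubProb.prod_eq_bind {X Y : Type u} [MeasurableSpace X] [MeasurableSpace Y] (μ : SubProb X)
    (ν : SubProb Y) : μ.prod ν = μ.bind fun x => ν.map (Prod.mk x) :=
  Subtype.ext (Measure.prod_def μ.1 ν.1)

lemma SubProb.measurable_map_prodMk {X Y : Type u} [MeasurableSpace X] [MeasurableSpace Y]
    (ν : SubProb Y) : Measurable fun x : X => ν.map (Prod.mk x) :=
  Measurable.subtype_mk Measurable.map_prodMk_left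

lemma renyiDivergence_isAdditive (hα : 1 < α) :
    (renyiDivergence.{u} α).toGraded.IsAdditive := by
  intro _ _ X _ Y _ μ₁ μ₂ μ₃ μ₄
  rw [SubProb.prod_eq_bind, SubProb.prod_eq_bind]
  refine (renyiDivergence_isComposable hα () () X (X × Y) _ _ (SubProb.measurable_map_prodMk μ₃)
    (SubProb.measurable_map_prodMk μ₄) μ₁ μ₂).trans ?_
  gcongr
  -- Each kernel value is a pushforward along y ↦ (x, y), so data processing bounds the divergence
  -- uniformly in x.
  exact iSup_le fun x => renyiDivergence_map_le hα measurable_prodMk_left μ₃ μ₄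

/-! ### Approximability by rounding kernels. -/

lemma tendsto_powerIntegral_of_finite (hα : 1 < α) {I : Type u} [MeasurableSpace I]
    [DiscreteMeasurableSpace I] [Finite I] {μ ν : ℕ → SubProb I} {μ₀ ν₀ : SubProb I}
    (hμ : ∀ i, Tendsto (fun n => (μ n).1 {i}) atTop (nhds (μ₀.1 {i})))
    (hν : ∀ i, Tendsto (fun n => (ν n).1 {i}) atTop (nhds (ν₀.1 {i})))
    (hμ₀ : ∀ i n, (μ n).1 {i} = 0 ↔ μ₀.1 {i} = 0) (hν₀ : ∀ i n, (ν n).1 {i} = 0 ↔ ν₀.1 {i} = 0) :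
    Tendsto (fun n => powerIntegral α (μ n) (ν n)) atTop (nhds (powerIntegral α μ₀ ν₀)) := by
  have := Fintype.ofFinite I
  simp only [powerIntegral_eq_sum hα]
  exact tendsto_finsetSum _ fun i _ => tendsto_powerIntegrand (hμ i) (hν i)
    (measure_ne_top _ _) (measure_ne_top _ _) (hμ₀ i) (hν₀ i)

/-- The cell of `f x` when the weights of subprobability measures on `I` are rounded up to
multiples of `1/(n+1)`. -/
noncomputable def SubProb.cell {X I : Type u} [MeasurableSpace I] (f : X → SubProb I) (n : ℕ)
    (x : X) (i : I) : Fin (n + 2) :=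
  ⟨⌈((n : ℝ) + 1) * (f x).1.real {i}⌉₊, by
    have h : (f x).1.real {i} ≤ 1 :=
      ENNReal.toReal_mono ENNReal.one_ne_top ((measure_mono (Set.subset_univ _)).trans (f x).2)
    refine Nat.lt_succ_of_le (Nat.ceil_le.2 ?_)
    push_cast
    have : (0 : ℝ) ≤ n := n.cast_nonneg
    nlinarith⟩

lemma SubProb.abs_sub_le_of_cell_eq {X I : Type u} [MeasurableSpace I] {f : X → SubProb I} {n : ℕ}
    {x y : X} {i : I} (h : cell f n x i = cell f n y i) :
    |(f x).1.real {i} - (f y).1.real {i}| ≤ 1 / ((n : ℝ) + 1) := by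
  have hn : (0 : ℝ) < n + 1 := by positivity
  have h' : ⌈((n : ℝ) + 1) * (f x).1.real {i}⌉₊ = ⌈((n : ℝ) + 1) * (f y).1.real {i}⌉₊ :=
    congrArg Fin.val h
  have hx := Nat.le_ceil (((n : ℝ) + 1) * (f x).1.real {i})
  have hy := Nat.le_ceil (((n : ℝ) + 1) * (f y).1.real {i})
  have hx' := Nat.ceil_lt_add_one (mul_nonneg hn.le (measureReal_nonneg (μ := (f x).1) (s := {i})))
  have hy' := Nat.ceil_lt_add_one (mul_nonneg hn.le (measureReal_nonneg (μ := (f y).1) (s := {i})))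
  rw [h'] at hx hx'
  rw [abs_le, neg_le, neg_sub, le_div_iff₀ hn, le_div_iff₀ hn]
  constructor <;> linarith

/-- This is why weights are rounded up: the ceiling is 0 only for weight 0, whereas rounding down
would also send small positive weights to 0. -/
lemma SubProb.eq_zero_iff_of_cell_eq {X I : Type u} [MeasurableSpace I] {f : X → SubProb I} {n : ℕ}
    {x y : X} {i : I} (h : cell f n x i = cell f n y i) :
    (f x).1 {i} = 0 ↔ (f y).1 {i} = 0 := by
  have hn : (0 : ℝ) < n + 1 := by positivity
  have key (z : X) : (f z).1 {i} = 0 ↔ (cell f n z i).val = 0 := by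
    rw [← measureReal_eq_zero_iff]
    simp only [cell, Nat.ceil_eq_zero]
    rw [mul_nonpos_iff_pos_imp_nonpos]
    have := measureReal_nonneg (μ := (f z).1) (s := {i})
    exact ⟨fun h => ⟨fun _ => h.le, fun _ => by linarith⟩, fun h => le_antisymm (h.1 hn) this⟩
  rw [key, key, h]

lemma SubProb.measurableSet_cell_eq {X I : Type u} [MeasurableSpace X] [MeasurableSpace I]
    [DiscreteMeasurableSpace I] [Finite I] {f : X → SubProb I} (hf : Measurable f) (n : ℕ)
    (c : I → Fin (n + 2)) : MeasurableSet {x | cell f n x = c} := by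
  have h : {x | cell f n x = c} =
      ⋂ i, {x | ⌈((n : ℝ) + 1) * (f x).1.real {i}⌉₊ = (c i).val} := by
    ext x
    simp [funext_iff, cell, Fin.ext_iff]
  rw [h]
  refine MeasurableSet.iInter fun i => ?_
  have hm : Measurable fun x => ⌈((n : ℝ) + 1) * (f x).1.real {i}⌉₊ :=
    ((measurable_coe_apply hf (measurableSet_singleton i)).ennreal_toReal.const_mul _).nat_ceil
  exact hm (measurableSet_singleton _)

/-- Staying in the same cell changes each weight by at most 1/(n+1), and all weights are at most 1,
so dominated convergence applies. -/
lemma SubProb.tendsto_bind_comp {X I : Type u} [MeasurableSpace X] [MeasurableSpace I]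
    [DiscreteMeasurableSpace I] {f : X → SubProb I} (hf : Measurable f)
    {r : ℕ → X → X} (hr : ∀ n, Measurable (r n)) (μ : SubProb X)
    (hc : ∀ n x, cell f n (r n x) = cell f n x) (i : I) :
    Tendsto (fun n => (μ.bind (f ∘ r n)).1 {i}) atTop (nhds ((μ.bind f).1 {i})) := by
  have hi := measurableSet_singleton i
  simp only [bind_apply hf μ hi, fun n => bind_apply (hf.comp (hr n)) μ hi]
  refine tendsto_lintegral_of_dominated_convergence (fun _ => 1)
    (fun n => measurable_coe_apply (hf.comp (hr n)) hi)
    (fun n => Eventually.of_forall fun x => (measure_mono (Set.subset_univ _)).trans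
      (f (r n x)).2) (by simp) (Eventually.of_forall fun x => ?_)
  rw [← ENNReal.tendsto_toReal_iff (fun n => measure_ne_top _ _) (measure_ne_top _ _)]
  refine tendsto_iff_dist_tendsto_zero.2 (squeeze_zero (fun _ => dist_nonneg) (fun n => ?_)
    tendsto_one_div_add_atTop_nhds_zero_nat)
  exact abs_sub_le_of_cell_eq (congrFun (hc n x) i)

lemma SubProb.bind_comp_eq_zero_iff {X I : Type u} [MeasurableSpace X] [MeasurableSpace I]
    [DiscreteMeasurableSpace I] {f : X → SubProb I} (hf : Measurable f)
    {r : X → X} (hr : Measurable r) (μ : SubProb X) {n : ℕ}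
    (hc : ∀ x, cell f n (r x) = cell f n x) (i : I) :
    (μ.bind (f ∘ r)).1 {i} = 0 ↔ (μ.bind f).1 {i} = 0 := by
  have hi := measurableSet_singleton i
  rw [bind_apply hf μ hi, bind_apply (hf.comp hr) μ hi,
    lintegral_eq_zero_iff (measurable_coe_apply hf hi),
    lintegral_eq_zero_iff (measurable_coe_apply (hf.comp hr) hi)]
  exact eventually_congr (Eventually.of_forall fun x =>
    eq_zero_iff_of_cell_eq (congrFun (hc x) i))

lemma renyiDivergence_isApproximable (hα : 1 < α) :
    (renyiDivergence.{u} α).toGraded.IsApproximable := by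
  intro _ X _ I _ _ _ f g hf hg μ₁ μ₂
  -- Recording the cells of f and g together lets one discretization serve both kernels.
  let Q (n : ℕ) (x : X) : (I → Fin (n + 2)) × (I → Fin (n + 2)) :=
    (SubProb.cell f n x, SubProb.cell g n x)
  -- Only cells that occur are kept, so each has a representative in X; this also covers empty X.
  -- Then `m n ∘ mstar n` moves every point within its own cell.
  let J (n : ℕ) : Type u := Set.range (Q n)
  let _ (n : ℕ) : MeasurableSpace (J n) := ⊤
  let mstar (n : ℕ) : X → J n := Set.rangeFactorization (Q n)
  let m (n : ℕ) : J n → X := fun j => j.2.choose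
  have hQ (n : ℕ) (x : X) : Q n (m n (mstar n x)) = Q n x := (mstar n x).2.choose_spec
  have hmstar (n : ℕ) : Measurable (mstar n) := measurable_to_countable' fun j => by
    have : mstar n ⁻¹' {j} =
        {x | SubProb.cell f n x = j.1.1} ∩ {x | SubProb.cell g n x = j.1.2} := by
      ext x
      exact Subtype.ext_iff.trans Prod.ext_iff
    rw [this]
    exact (SubProb.measurableSet_cell_eq hf n _).inter (SubProb.measurableSet_cell_eq hg n _)
  have hm (n : ℕ) : Measurable (m n) := measurable_from_top
  have hr (n : ℕ) : Measurable (m n ∘ mstar n) := (hm n).comp (hmstar n)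
  have hcf (n : ℕ) (x : X) : SubProb.cell f n ((m n ∘ mstar n) x) = SubProb.cell f n x :=
    congrArg Prod.fst (hQ n x)
  have hcg (n : ℕ) (x : X) : SubProb.cell g n ((m n ∘ mstar n) x) = SubProb.cell g n x :=
    congrArg Prod.snd (hQ n x)
  refine ⟨J, fun _ => ⊤, fun _ => inferInstance, fun n => inferInstanceAs (Finite (Set.range (Q n))),
    mstar, m, hmstar, hm, ?_⟩
  exact (continuous_renyiLog.tendsto _).comp (tendsto_powerIntegral_of_finite hα
    (SubProb.tendsto_bind_comp hf hr μ₁ hcf) (SubProb.tendsto_bind_comp hg hr μ₂ hcg)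
    (fun i n => SubProb.bind_comp_eq_zero_iff hf (hr n) μ₁ (hcf n) i)
    (fun i n => SubProb.bind_comp_eq_zero_iff hg (hr n) μ₂ (hcg n) i))

end Properties

theorem mainTheorem4 (α : ℝ) (hα : 1 < α) :
    (renyiDivergence.{u} α).toGraded.IsReflexive ∧
    (renyiDivergence.{u} α).toGraded.IsContinuous ∧
    (renyiDivergence.{u} α).toGraded.IsApproximable ∧
    (renyiDivergence.{u} α).toGraded.IsComposable ∧
    (renyiDivergence.{u} α).toGraded.IsAdditive :=
  ⟨renyiDivergence_isReflexive hα, renyiDivergence_isContinuous hα,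
    renyiDivergence_isApproximable hα, renyiDivergence_isComposable hα,
    renyiDivergence_isAdditive hα⟩
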